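/- Let $(R,\partial)$ be a commutative differential ring (with identity) whose ring of constants $\{r\in R\mid \partial(r)=0\}$ is a field of characteristic zero. Let $R((\partial^{-1}))$ be the ring of pseudo-differential operators $\sum_{-\infty<i\le N}a_i\partial^i$ ($a_i\in R$, $N\in\mathbb{Z}$), with multiplication determined by $$a\partial^i\cdot b\partial^j=\sum_{k\ge 0}\binom{i}{k}\,a\,\partial^k(b)\,\partial^{i+j-k}\qquad(a,b\in R,\ i,j\in\mathbb{Z}),$$ and let $R[\partial]\subset R((\partial^{-1}))$ be the subring of differential operators, i.e. of those operators with $a_i=0$ for all $i<0$. The order $\operatorname{ord}(A)$ of an operator $A=\sum a_i\partial^i\neq 0$ is the largest $i$ with $a_i\neq 0$, with $\operatorname{ord}(0)=-\infty$; the positive part of $A$ is $A_+=\sum_{i\ge 0}a_i\partial^i\in R[\partial]$; and $[A,B]=AB-BA$. Let $L\in R[\partial]$ be a monic differential operator of order $n$ (that is, of order $n$ with coefficient of $\partial^n$ equal to $1$). Put $$W(L)=\{A\in R[\partial]\mid \operatorname{ord}([L,A])\le n-2\},\qquad \mathcal{Z}((L))=\{B\in R((\partial^{-1}))\mid [L,B]=0\}.$$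 Then $$\{B_+\mid B\in\mathcal{Z}((L))\}=W(L).$$ -/

import Mathlib

open scoped Differential

/-- The subring of constants of a differential ring: the elements with derivative zero. -/
def constants (R : Type*) [CommRing R] [Differential R] : Subring R where
  carrier := {r | r′ = 0}
  zero_mem' := by simp
  one_mem' := by simp
  add_mem' := by
    intro a b ha hb
    simp only [Set.mem_ofPred_eq] at ha hb ⊢
    simp [ha, hb]
  mul_mem' := by
    intro a b ha hb
    simp only [Set.mem_ofPred_eq] at ha hb ⊢
    simp [ha, hb]
  neg_mem' := by
    intro a ha
    simp only [Set.mem_ofPred_eq] at ha ⊢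
    simp [ha]

/-- Families `(a i)`, `i ∈ ℤ`, of elements of `R` that vanish for all large `i`. -/
def boundedAboveFamilies (R : Type*) [CommRing R] : AddSubgroup (ℤ → R) where
  carrier := {a | ∃ N : ℤ, ∀ i, N < i → a i = 0}
  zero_mem' := ⟨0, fun _ _ => rfl⟩
  add_mem' := by
    rintro a b ⟨N, hN⟩ ⟨M, hM⟩
    refine ⟨max N M, fun i hi => ?_⟩
    simp [hN i (lt_of_le_of_lt (le_max_left _ _) hi), hM i (lt_of_le_of_lt (le_max_right _ _) hi)]
  neg_mem' := by
    rintro a ⟨N, hN⟩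
    exact ⟨N, fun i hi => by simp [hN i hi]⟩

/-- The pseudo-differential operators `∑_{-∞ < i ≤ N} a i ∂^i` over `R`, i.e. `R((∂⁻¹))`; such an
operator is given by its family of (left) coefficients. -/
def PseudoDiffOp (R : Type*) [CommRing R] : Type _ := boundedAboveFamilies R

namespace PseudoDiffOp

/-- Addition is coefficientwise. -/
instance {R : Type*} [CommRing R] : AddCommGroup (PseudoDiffOp R) :=
  inferInstanceAs (AddCommGroup (boundedAboveFamilies R))

/-- The coefficient of `∂^i`. -/
def coeff {R : Type*} [CommRing R] (A : PseudoDiffOp R) (i : ℤ) : R := A.1 i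

theorem ext {R : Type*} [CommRing R] {A B : PseudoDiffOp R} (h : ∀ i, A.coeff i = B.coeff i) :
    A = B :=
  Subtype.ext (funext h)

theorem coeff_add {R : Type*} [CommRing R] (A B : PseudoDiffOp R) (i : ℤ) :
    (A + B).coeff i = A.coeff i + B.coeff i := rfl

theorem coeff_neg {R : Type*} [CommRing R] (A : PseudoDiffOp R) (i : ℤ) :
    (-A).coeff i = -A.coeff i := rfl

theorem coeff_zero {R : Type*} [CommRing R] (i : ℤ) : (0 : PseudoDiffOp R).coeff i = 0 := rfl

theorem exists_bound {R : Type*} [CommRing R] (A : PseudoDiffOp R) :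
    ∃ N : ℤ, ∀ i, N < i → A.coeff i = 0 := A.2

/-- The operator `a ∂^i`. -/
def monomial {R : Type*} [CommRing R] (i : ℤ) (a : R) : PseudoDiffOp R :=
  ⟨fun j => if j = i then a else 0, i, fun _ hj => if_neg hj.ne'⟩

theorem coeff_monomial {R : Type*} [CommRing R] (i : ℤ) (a : R) (j : ℤ) :
    (monomial i a).coeff j = if j = i then a else 0 := rfl

/-- The `m`-th coefficient of a product: from
`(a ∂^i)(b ∂^j) = ∑_{k ≥ 0} (i choose k) a b^{(k)} ∂^{i + j - k}`, the pairs `(i, k)` contribute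
`(i choose k) a_i (b_{m - i + k})^{(k)}`. Only finitely many of these summands are non-zero. -/
noncomputable def mulCoeff {R : Type*} [CommRing R] [Differential R] (A B : PseudoDiffOp R)
    (m : ℤ) : R :=
  ∑ᶠ p : ℤ × ℕ,
    Ring.choose p.1 p.2 • (A.coeff p.1 * (⇑(Differential.deriv (R := R)))^[p.2]
      (B.coeff (m - p.1 + p.2)))

/-- Triples of natural numbers with sum `t`. -/
def triples (t : ℕ) : Finset (ℕ × ℕ × ℕ) :=
  (Finset.range (t + 1) ×ˢ Finset.range (t + 1) ×ˢ Finset.range (t + 1)).filter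
    fun p => p.1 + p.2.1 + p.2.2 = t

theorem mem_triples {t : ℕ} {p : ℕ × ℕ × ℕ} : p ∈ triples t ↔ p.1 + p.2.1 + p.2.2 = t := by
  simp only [triples, Finset.mem_filter, Finset.mem_product, Finset.mem_range]
  omega

/-- Quadruples of natural numbers with sum `t`. -/
def quadruples (t : ℕ) : Finset (ℕ × ℕ × ℕ × ℕ) :=
  (Finset.range (t + 1) ×ˢ Finset.range (t + 1) ×ˢ Finset.range (t + 1) ×ˢ
    Finset.range (t + 1)).filter fun p => p.1 + p.2.1 + p.2.2.1 + p.2.2.2 = t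

theorem mem_quadruples {t : ℕ} {p : ℕ × ℕ × ℕ × ℕ} :
    p ∈ quadruples t ↔ p.1 + p.2.1 + p.2.2.1 + p.2.2.2 = t := by
  simp only [quadruples, Finset.mem_filter, Finset.mem_product, Finset.mem_range]
  omega

theorem iterate_deriv_zero {R : Type*} [CommRing R] [Differential R] (k : ℕ) :
    (⇑(Differential.deriv (R := R)))^[k] 0 = 0 :=
  iterate_map_zero _ k

theorem iterate_deriv_sum {R : Type*} [CommRing R] [Differential R] (k : ℕ) {ι : Type*}
    (s : Finset ι) (f : ι → R) :
    (⇑(Differential.deriv (R := R)))^[k] (∑ i ∈ s, f i) =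
      ∑ i ∈ s, (⇑(Differential.deriv (R := R)))^[k] (f i) := by
  induction k with
  | zero => rfl
  | succ k ih => simp only [Function.iterate_succ_apply', ih, map_sum]

theorem iterate_deriv_zsmul {R : Type*} [CommRing R] [Differential R] (k : ℕ) (c : ℤ) (a : R) :
    (⇑(Differential.deriv (R := R)))^[k] (c • a) =
      c • (⇑(Differential.deriv (R := R)))^[k] a := by
  induction k with
  | zero => rfl
  | succ k ih => simp only [Function.iterate_succ_apply', ih, map_zsmul]

theorem iterate_deriv_mul {R : Type*} [CommRing R] [Differential R] (k : ℕ) (a b : R) :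
    (⇑(Differential.deriv (R := R)))^[k] (a * b) =
      ∑ ij ∈ Finset.HasAntidiagonal.antidiagonal k, k.choose ij.1 •
        ((⇑(Differential.deriv (R := R)))^[ij.1] a *
          (⇑(Differential.deriv (R := R)))^[ij.2] b) := by
  induction k with
  | zero => simp
  | succ k ih =>
    rw [Finset.sum_antidiagonal_choose_succ_nsmul (M := R)
      (fun i j => (⇑(Differential.deriv (R := R)))^[i] a *
          (⇑(Differential.deriv (R := R)))^[j] b) k]
    simp only [Function.iterate_succ_apply', ih, map_sum, map_nsmul, Derivation.leibniz,
      smul_add, Finset.sum_add_distrib, smul_eq_mul]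
    congr 1
    refine Finset.sum_congr rfl fun ij hij => ?_
    rw [mul_comm, Nat.choose_symm_of_eq_add (Finset.HasAntidiagonal.mem_antidiagonal.1 hij).symm]

/-- The product coefficients as explicit finite sums, given bounds for the orders. -/
theorem mulCoeff_eq {R : Type*} [CommRing R] [Differential R] {A B : PseudoDiffOp R} {N M : ℤ}
    (hA : ∀ i, N < i → A.coeff i = 0) (hB : ∀ i, M < i → B.coeff i = 0) (t : ℕ) :
    mulCoeff A B (N + M - t) = ∑ p ∈ triples t,
      Ring.choose (N - p.1) p.2.1 • (A.coeff (N - p.1) *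
        (⇑(Differential.deriv (R := R)))^[p.2.1] (B.coeff (M - p.2.2))) := by
  let e : ℕ × ℕ × ℕ → ℤ × ℕ := fun p => (N - p.1, p.2.1)
  have he : Set.InjOn e (triples t) := by
    rintro ⟨a, b, c⟩ h ⟨a', b', c'⟩ h' heq
    simp only [Finset.mem_coe, mem_triples, e, Prod.mk.injEq] at *
    omega
  rw [mulCoeff, finsum_eq_sum_of_support_subset (s := (triples t).image e),
    Finset.sum_image he]
  · refine Finset.sum_congr rfl fun p hp => ?_
    rw [mem_triples] at hp
    have : N + M - (t : ℤ) - (N - p.1) + p.2.1 = M - p.2.2 := by omega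
    simp only [e, this]
  · rintro ⟨i, k⟩ hik
    rw [Function.mem_support] at hik
    have h1 : i ≤ N := by
      by_contra h
      exact hik (by simp [hA i (not_le.1 h)])
    have h2 : N + M - t - i + k ≤ M := by
      by_contra h
      exact hik (by simp [hB _ (not_le.1 h)])
    rw [Finset.mem_coe, Finset.mem_image]
    refine ⟨((N - i).toNat, k, (M - (N + M - t - i + k)).toNat), ?_, ?_⟩
    · rw [mem_triples]
      dsimp only
      omega
    · simp only [e, Prod.mk.injEq, and_true]
      omega

theorem mulCoeff_eq_zero {R : Type*} [CommRing R] [Differential R] {A B : PseudoDiffOp R}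
    {N M : ℤ} (hA : ∀ i, N < i → A.coeff i = 0) (hB : ∀ i, M < i → B.coeff i = 0) {m : ℤ}
    (hm : N + M < m) : mulCoeff A B m = 0 := by
  refine finsum_eq_zero_of_forall_eq_zero fun p => ?_
  by_cases h : N < p.1
  · simp [hA _ h]
  · rw [hB _ (by omega), iterate_deriv_zero, mul_zero, smul_zero]

/-- Multiplication of pseudo-differential operators, extending `∂ r = r ∂ + r′`. -/
noncomputable instance {R : Type*} [CommRing R] [Differential R] : Mul (PseudoDiffOp R) where
  mul A B := ⟨mulCoeff A B, by
    obtain ⟨N, hN⟩ := A.exists_bound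
    obtain ⟨M, hM⟩ := B.exists_bound
    exact ⟨N + M, fun i hi => mulCoeff_eq_zero hN hM hi⟩⟩

noncomputable instance {R : Type*} [CommRing R] : One (PseudoDiffOp R) where
  one := monomial 0 1

theorem coeff_one {R : Type*} [CommRing R] (i : ℤ) :
    (1 : PseudoDiffOp R).coeff i = if i = 0 then 1 else 0 := rfl

theorem coeff_mul {R : Type*} [CommRing R] [Differential R] (A B : PseudoDiffOp R) (m : ℤ) :
    (A * B).coeff m = mulCoeff A B m := rfl

theorem coeff_mul_eq {R : Type*} [CommRing R] [Differential R] {A B : PseudoDiffOp R} {N M : ℤ}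
    (hA : ∀ i, N < i → A.coeff i = 0) (hB : ∀ i, M < i → B.coeff i = 0) (t : ℕ) :
    (A * B).coeff (N + M - t) = ∑ p ∈ triples t,
      Ring.choose (N - p.1) p.2.1 • (A.coeff (N - p.1) *
        (⇑(Differential.deriv (R := R)))^[p.2.1] (B.coeff (M - p.2.2))) :=
  mulCoeff_eq hA hB t

theorem coeff_mul_eq_zero {R : Type*} [CommRing R] [Differential R] {A B : PseudoDiffOp R}
    {N M : ℤ} (hA : ∀ i, N < i → A.coeff i = 0) (hB : ∀ i, M < i → B.coeff i = 0) (m : ℤ)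
    (hm : N + M < m) : (A * B).coeff m = 0 :=
  mulCoeff_eq_zero hA hB hm

theorem choose_mul_sum (i j : ℤ) (k p : ℕ) :
    ∑ rq ∈ Finset.HasAntidiagonal.antidiagonal p,
      (Ring.choose i (k + rq.1) * Ring.choose j rq.2 * ((k + rq.1).choose k : ℤ)) =
    Ring.choose i k * Ring.choose (i + j - k) p := by
  have h : i + j - k = (i - k) + j := by ring
  rw [h, Ring.add_choose_eq p (Commute.all (i - (k : ℤ)) j), Finset.mul_sum]
  refine Finset.sum_congr rfl fun rq _ => ?_
  have := Ring.choose_smul_choose i (Nat.le_add_right k rq.1)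
  rw [Nat.add_sub_cancel_left, nsmul_eq_mul] at this
  linear_combination (Ring.choose j rq.2) * this

theorem mul_assoc' {R : Type*} [CommRing R] [Differential R] (A B C : PseudoDiffOp R) :
    A * B * C = A * (B * C) := by
  obtain ⟨N, hN⟩ := A.exists_bound
  obtain ⟨M, hM⟩ := B.exists_bound
  obtain ⟨P, hP⟩ := C.exists_bound
  have hNM := coeff_mul_eq_zero hN hM
  have hMP := coeff_mul_eq_zero hM hP
  apply ext
  intro m
  by_cases hm : N + M + P < m
  · rw [coeff_mul_eq_zero hNM hP m hm, coeff_mul_eq_zero hN hMP m (by omega)]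
  obtain ⟨t, rfl⟩ : ∃ t : ℕ, m = N + M + P - t := ⟨(N + M + P - m).toNat, by omega⟩
  rw [coeff_mul_eq hNM hP, add_assoc N M P, coeff_mul_eq hN hMP]
  simp only [coeff_mul_eq hN hM, coeff_mul_eq hM hP, iterate_deriv_sum, iterate_deriv_zsmul,
    iterate_deriv_mul, Finset.mul_sum, Finset.sum_mul, Finset.smul_sum]
  trans ∑ w ∈ quadruples t, ∑ kp ∈ Finset.HasAntidiagonal.antidiagonal w.2.2.2,
    (Ring.choose (N - w.1) kp.1 * Ring.choose ((N - w.1) + (M - w.2.1) - kp.1) kp.2) •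
      (A.coeff (N - w.1) * ((⇑(Differential.deriv (R := R)))^[kp.1] (B.coeff (M - w.2.1)) *
        (⇑(Differential.deriv (R := R)))^[kp.2] (C.coeff (P - w.2.2.1))))
  · rw [Finset.sum_sigma', Finset.sum_sigma']
    refine Finset.sum_nbij' (fun a => ⟨(a.2.1, a.2.2.2, a.1.2.2, a.2.2.1 + a.1.2.1),
        (a.2.2.1, a.1.2.1)⟩)
      (fun b => ⟨(b.1.1 + b.1.2.1 + b.2.1, b.2.2, b.1.2.2.1), (b.1.1, b.2.1, b.1.2.1)⟩)
      ?_ ?_ ?_ ?_ ?_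
    · rintro ⟨⟨u, p, z⟩, ⟨x, k, y⟩⟩ h
      simp only [Finset.mem_sigma, mem_triples, mem_quadruples,
        Finset.HasAntidiagonal.mem_antidiagonal, and_true] at h ⊢
      omega
    · rintro ⟨⟨x, y, z, w⟩, ⟨k, p⟩⟩ h
      simp only [Finset.mem_sigma, mem_triples, mem_quadruples,
        Finset.HasAntidiagonal.mem_antidiagonal, and_true] at h ⊢
      omega
    · rintro ⟨⟨u, p, z⟩, ⟨x, k, y⟩⟩ h
      simp only [Finset.mem_sigma, mem_triples] at h
      obtain ⟨h1, rfl⟩ := h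
      simp only [Sigma.mk.injEq, Prod.mk.injEq, heq_eq_eq, and_true]
      omega
    · rintro ⟨⟨x, y, z, w⟩, ⟨k, p⟩⟩ h
      simp only [Finset.mem_sigma, mem_quadruples, Finset.HasAntidiagonal.mem_antidiagonal] at h
      obtain ⟨h1, rfl⟩ := h
      rfl
    · rintro ⟨⟨u, p, z⟩, ⟨x, k, y⟩⟩ h
      simp only [Finset.mem_sigma, mem_triples] at h
      obtain ⟨h1, rfl⟩ := h
      have : N + M - ((x + k + y : ℕ) : ℤ) = (N - x) + (M - y) - k := by push_cast; ring
      simp only [this, zsmul_eq_mul]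
      push_cast
      ring
  · trans ∑ w ∈ quadruples t, ∑ kp ∈ Finset.HasAntidiagonal.antidiagonal w.2.2.2,
      ∑ rq ∈ Finset.HasAntidiagonal.antidiagonal kp.2,
      (Ring.choose (N - w.1) (kp.1 + rq.1) * Ring.choose (M - w.2.1) rq.2 *
        ((kp.1 + rq.1).choose kp.1 : ℤ)) •
      (A.coeff (N - w.1) * ((⇑(Differential.deriv (R := R)))^[kp.1] (B.coeff (M - w.2.1)) *
        (⇑(Differential.deriv (R := R)))^[kp.2] (C.coeff (P - w.2.2.1))))
    · refine Finset.sum_congr rfl fun w _ => Finset.sum_congr rfl fun kp _ => ?_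
      rw [← Finset.sum_smul, choose_mul_sum]
    · rw [Finset.sum_sigma', Finset.sum_sigma', Finset.sum_sigma', Finset.sum_sigma']
      refine Finset.sum_nbij'
        (fun a => ⟨⟨(a.1.1.1, a.1.2.1 + a.2.1, a.1.1.2.1 + a.2.2 + a.1.1.2.2.1),
            (a.1.1.2.1, a.2.2, a.1.1.2.2.1)⟩, (a.1.2.1, a.2.1)⟩)
        (fun b => ⟨⟨(b.1.1.1, b.1.2.1, b.1.2.2.2, b.2.1 + (b.2.2 + b.1.2.2.1)),
            (b.2.1, b.2.2 + b.1.2.2.1)⟩, (b.2.2, b.1.2.2.1)⟩)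
        ?_ ?_ ?_ ?_ ?_
      · rintro ⟨⟨⟨x, y, z, w⟩, ⟨k, p⟩⟩, ⟨r, q⟩⟩ h
        simp only [Finset.mem_sigma, mem_triples, mem_quadruples,
        Finset.HasAntidiagonal.mem_antidiagonal, and_true] at h ⊢
        omega
      · rintro ⟨⟨⟨x, k, v⟩, ⟨y, q, z⟩⟩, ⟨s, r⟩⟩ h
        simp only [Finset.mem_sigma, mem_triples, mem_quadruples,
        Finset.HasAntidiagonal.mem_antidiagonal, and_true] at h ⊢
        omega
      · rintro ⟨⟨⟨x, y, z, w⟩, ⟨k, p⟩⟩, ⟨r, q⟩⟩ h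
        simp only [Finset.mem_sigma, mem_quadruples, Finset.HasAntidiagonal.mem_antidiagonal] at h
        obtain ⟨⟨h1, rfl⟩, rfl⟩ := h
        rfl
      · rintro ⟨⟨⟨x, k, v⟩, ⟨y, q, z⟩⟩, ⟨s, r⟩⟩ h
        simp only [Finset.mem_sigma, mem_triples, Finset.HasAntidiagonal.mem_antidiagonal] at h
        obtain ⟨⟨h1, rfl⟩, rfl⟩ := h
        rfl
      · rintro ⟨⟨⟨x, y, z, w⟩, ⟨k, p⟩⟩, ⟨r, q⟩⟩ h
        simp only [Finset.mem_sigma, mem_quadruples, Finset.HasAntidiagonal.mem_antidiagonal] at h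
        obtain ⟨⟨h1, rfl⟩, rfl⟩ := h
        simp only [Function.iterate_add_apply, zsmul_eq_mul, nsmul_eq_mul]
        push_cast
        ring

theorem finite_support_mulCoeff {R : Type*} [CommRing R] [Differential R]
    (A B : PseudoDiffOp R) (m : ℤ) :
    (Function.support fun p : ℤ × ℕ => Ring.choose p.1 p.2 • (A.coeff p.1 *
      (⇑(Differential.deriv (R := R)))^[p.2] (B.coeff (m - p.1 + p.2)))).Finite := by
  obtain ⟨N, hN⟩ := A.exists_bound
  obtain ⟨M, hM⟩ := B.exists_bound
  refine ((Set.finite_Icc (m - M) N).prod (Set.finite_Iic (M - m + N).toNat)).subset ?_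
  rintro ⟨i, k⟩ hik
  rw [Function.mem_support] at hik
  have h1 : i ≤ N := by
    by_contra h
    exact hik (by simp [hN i (not_le.1 h)])
  have h2 : m - i + k ≤ M := by
    by_contra h
    exact hik (by simp [hM _ (not_le.1 h)])
  simp only [Set.mem_prod, Set.mem_Icc, Set.mem_Iic]
  omega

/-- `R((∂⁻¹))` is an associative ring with identity `∂^0`. -/
noncomputable instance {R : Type*} [CommRing R] [Differential R] : Ring (PseudoDiffOp R) :=
  { (inferInstance : AddCommGroup (PseudoDiffOp R)),
    (inferInstance : Mul (PseudoDiffOp R)),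
    (inferInstance : One (PseudoDiffOp R)) with
    mul_assoc := mul_assoc'
    left_distrib := fun A B C => by
      apply ext
      intro m
      rw [coeff_add, coeff_mul, coeff_mul, coeff_mul, mulCoeff, mulCoeff, mulCoeff,
        ← finsum_add_distrib (finite_support_mulCoeff A B m) (finite_support_mulCoeff A C m)]
      refine finsum_congr fun p => ?_
      rw [coeff_add, iterate_map_add, mul_add, smul_add]
    right_distrib := fun A B C => by
      apply ext
      intro m
      rw [coeff_add, coeff_mul, coeff_mul, coeff_mul, mulCoeff, mulCoeff, mulCoeff,
        ← finsum_add_distrib (finite_support_mulCoeff A C m) (finite_support_mulCoeff B C m)]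
      refine finsum_congr fun p => ?_
      rw [coeff_add, add_mul, smul_add]
    zero_mul := fun A => by
      apply ext
      intro m
      refine finsum_eq_zero_of_forall_eq_zero fun p => ?_
      rw [coeff_zero, zero_mul, smul_zero]
    mul_zero := fun A => by
      apply ext
      intro m
      refine finsum_eq_zero_of_forall_eq_zero fun p => ?_
      rw [coeff_zero, iterate_deriv_zero, mul_zero, smul_zero]
    one_mul := fun A => by
      apply ext
      intro m
      rw [coeff_mul, mulCoeff, finsum_eq_single _ ((0, 0) : ℤ × ℕ)]
      · simp [coeff_one]
      · rintro ⟨i, k⟩ h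
        by_cases hi : i = 0
        · subst hi
          have hk : k ≠ 0 := fun hk => h (by rw [hk])
          simp [Ring.choose_zero_pos ℤ (Nat.pos_of_ne_zero hk)]
        · simp [coeff_one, hi]
    mul_one := fun A => by
      apply ext
      intro m
      rw [coeff_mul, mulCoeff, finsum_eq_single _ ((m, 0) : ℤ × ℕ)]
      · simp [coeff_one]
      · rintro ⟨i, k⟩ h
        rcases Nat.eq_zero_or_pos k with rfl | hk
        · have hi : m - i ≠ 0 := fun hi => h (by rw [show i = m by omega])
          simp [coeff_one, hi]
        · obtain ⟨k, rfl⟩ := Nat.exists_eq_succ_of_ne_zero hk.ne'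
          dsimp only
          rw [coeff_one, Function.iterate_succ_apply, apply_ite (Differential.deriv (R := R)),
            Derivation.map_one_eq_zero, map_zero, ite_self, iterate_deriv_zero, mul_zero,
            smul_zero]
    neg_add_cancel := fun A => neg_add_cancel A }

open Classical in
/-- The order: the largest `i` with non-zero coefficient of `∂^i`; the order of `0` is `-∞`. -/
noncomputable def ord {R : Type*} [CommRing R] (A : PseudoDiffOp R) : WithBot ℤ :=
  if A = 0 then ⊥ else ((sSup {i : ℤ | A.coeff i ≠ 0} : ℤ) : WithBot ℤ)

theorem ord_le_iff {R : Type*} [CommRing R] (A : PseudoDiffOp R) (m : ℤ) :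
    A.ord ≤ (m : WithBot ℤ) ↔ ∀ i, m < i → A.coeff i = 0 := by
  unfold ord
  split_ifs with h
  · subst h
    simp [coeff_zero]
  · obtain ⟨N, hN⟩ := A.exists_bound
    have hb : BddAbove {i : ℤ | A.coeff i ≠ 0} :=
      ⟨N, fun i hi => not_lt.1 fun h => hi (hN i h)⟩
    have hne : {i : ℤ | A.coeff i ≠ 0}.Nonempty := by
      by_contra hc
      rw [Set.not_nonempty_iff_eq_empty, Set.eq_empty_iff_forall_notMem] at hc
      exact h (ext fun i => by simpa [coeff_zero] using hc i)
    rw [WithBot.coe_le_coe, csSup_le_iff hb hne]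
    refine forall_congr' fun i => ?_
    simp only [Set.mem_ofPred_eq]
    constructor
    · intro h1 h2
      by_contra h3
      exact absurd (h1 h3) (not_le.2 h2)
    · intro h1 h2
      exact not_lt.1 fun h3 => h2 (h1 h3)

end PseudoDiffOp

/-- The ring `R[∂]` of differential operators: the subring of `R((∂⁻¹))` of the operators
`∑_{i ≥ 0} a i ∂^i` (finite sums, as the coefficients vanish for large `i`). On it the product
is the one determined by `∂ r = r ∂ + r′`. -/
noncomputable def diffOp (R : Type*) [CommRing R] [Differential R] :
    Subring (PseudoDiffOp R) where
  carrier := {A | ∀ i, i < 0 → A.coeff i = 0}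
  zero_mem' := fun _ _ => rfl
  one_mem' := fun i hi => by rw [PseudoDiffOp.coeff_one, if_neg hi.ne]
  add_mem' := fun {A B} hA hB i hi => by
    rw [PseudoDiffOp.coeff_add, hA i hi, hB i hi, add_zero]
  neg_mem' := fun {A} hA i hi => by rw [PseudoDiffOp.coeff_neg, hA i hi, neg_zero]
  mul_mem' := fun {A B} hA hB m hm => by
    rw [PseudoDiffOp.coeff_mul]
    refine finsum_eq_zero_of_forall_eq_zero fun p => ?_
    rcases lt_or_ge p.1 0 with h | h
    · rw [hA _ h, zero_mul, smul_zero]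
    rcases lt_or_ge (m - p.1 + p.2) 0 with h' | h'
    · rw [hB _ h', PseudoDiffOp.iterate_deriv_zero, mul_zero, smul_zero]
    · obtain ⟨n, hn⟩ := Int.eq_ofNat_of_zero_le h
      rw [hn, Ring.choose_natCast, Nat.choose_eq_zero_of_lt (by omega), Nat.cast_zero, zero_smul]

/-- The positive part `A₊ = ∑_{i ≥ 0} a i ∂^i` of `A = ∑ a i ∂^i`, a differential operator. -/
def PseudoDiffOp.posPart {R : Type*} [CommRing R] [Differential R] (A : PseudoDiffOp R) :
    diffOp R :=
  ⟨⟨fun i => if 0 ≤ i then A.coeff i else 0, by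
    obtain ⟨N, hN⟩ := A.exists_bound
    exact ⟨N, fun i hi => by simp [hN i hi]⟩⟩, fun _ hi => if_neg (not_le.2 hi)⟩

/-- `L` is a monic differential operator of order `n`: `L = ∂^n + (terms of lower order)`. -/
def IsMonicOfOrder {R : Type*} [CommRing R] [Differential R] (L : diffOp R) (n : ℕ) : Prop :=
  (L : PseudoDiffOp R).ord = ((n : ℤ) : WithBot ℤ) ∧ (L : PseudoDiffOp R).coeff n = 1

/-- `W(L)`, for `L` of order `n`: the differential operators `A` that almost commute with `L`,
i.e. such that `[L, A] = L A - A L` has order at most `n - 2`. -/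
def almostCommuting {R : Type*} [CommRing R] [Differential R] (L : diffOp R) (n : ℕ) :
    Set (diffOp R) :=
  {A | ((⁅L, A⁆ : diffOp R) : PseudoDiffOp R).ord ≤ (((n : ℤ) - 2 : ℤ) : WithBot ℤ)}

/-- `Z((L))`: the centralizer of `L` in the ring of pseudo-differential operators. -/
def pseudoCentralizer {R : Type*} [CommRing R] [Differential R] (L : diffOp R) :
    Set (PseudoDiffOp R) :=
  {B | ⁅(L : PseudoDiffOp R), B⁆ = 0}

/-! Since `R` is commutative, leading terms cancel in a commutator, so `⁅A, B⁆` has order at most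
`ord A + ord B - 1` (`OrdLE.lie`). If `B` commutes with `L`, then `⁅L, B₊⁆ = ⁅L, B₊ - B⁆`, and `B₊ -
B` has order at most `-1`; this gives the bound `n - 2`.

Conversely, let `A` almost commute with `L`, with leading term `a ∂^m`, `m ≥ 0`. By
`OrdLE.coeff_lie` the coefficient of `∂^(n+m-1)` in `⁅L, A⁆` is `n a′`. As `n + m - 1 > n - 2`, it
vanishes, and for `n ≠ 0` the hypotheses on the constants make `n` invertible, so `a` is constant.
Now `L` has a monic `n`-th root `Q` of order one (`exists_pow_eq`), and `a Q^m` commutes with `L`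
and has the leading term of `A`. Subtracting it lowers the order and leaves `⁅L, A⁆` unchanged. Once
the order is negative, the sum of the subtracted operators is an element of the centralizer with
positive part `A`. -/

namespace PseudoDiffOp

/-- `A` has no terms of order larger than `m`. -/
def OrdLE {R : Type*} [CommRing R] (A : PseudoDiffOp R) (m : ℤ) : Prop :=
  ∀ i, m < i → A.coeff i = 0

theorem coeff_sub {R : Type*} [CommRing R] [Differential R] (A B : PseudoDiffOp R) (i : ℤ) :
    (A - B).coeff i = A.coeff i - B.coeff i := by
  rw [sub_eq_add_neg, coeff_add, coeff_neg, sub_eq_add_neg]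

theorem ordLE_monomial {R : Type*} [CommRing R] (i : ℤ) (a : R) : (monomial i a).OrdLE i :=
  fun _ hj => if_neg hj.ne'

theorem lie_sub_of_commute {R : Type*} [CommRing R] [Differential R] {L C : PseudoDiffOp R}
    (h : Commute L C) (A : PseudoDiffOp R) : ⁅L, A - C⁆ = ⁅L, A⁆ := by
  rw [Ring.lie_def, Ring.lie_def, mul_sub, sub_mul, h.eq, sub_sub_sub_cancel_right]

/-! ### Leading coefficients of products, commutators and powers -/

namespace OrdLE

variable {R : Type*} [CommRing R] {A B : PseudoDiffOp R} {M N : ℤ}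

theorem mono (hA : A.OrdLE N) (h : N ≤ M) : A.OrdLE M :=
  fun i hi => hA i (h.trans_lt hi)

theorem add (hA : A.OrdLE N) (hB : B.OrdLE N) : (A + B).OrdLE N :=
  fun i hi => by rw [coeff_add, hA i hi, hB i hi, add_zero]

theorem sub [Differential R] (hA : A.OrdLE N) (hB : B.OrdLE N) : (A - B).OrdLE N :=
  fun i hi => by rw [coeff_sub, hA i hi, hB i hi, sub_zero]

theorem of_coeff_eq_zero (hA : A.OrdLE N) (h : A.coeff N = 0) : A.OrdLE (N - 1) := by
  intro i hi
  rcases (show N ≤ i by omega).eq_or_lt with rfl | hi'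
  · exact h
  · exact hA i hi'

theorem mul [Differential R] (hA : A.OrdLE N) (hB : B.OrdLE M) : (A * B).OrdLE (N + M) :=
  coeff_mul_eq_zero hA hB

theorem coeff_mul_add [Differential R] (hA : A.OrdLE N) (hB : B.OrdLE M) :
    (A * B).coeff (N + M) = A.coeff N * B.coeff M := by
  have h := coeff_mul_eq hA hB 0
  have ht : triples 0 = {(0, 0, 0)} := by decide
  rw [ht, Finset.sum_singleton] at h
  simpa using h

theorem coeff_mul_add_sub_one [Differential R] (hA : A.OrdLE N) (hB : B.OrdLE M) :
    (A * B).coeff (N + M - 1) = A.coeff N * B.coeff (M - 1) + A.coeff (N - 1) * B.coeff M +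
      N * (A.coeff N * (B.coeff M)′) := by
  have h := coeff_mul_eq hA hB 1
  -- One unit of order is lost in the right factor, in the left factor, or to one derivative; the
  -- last carries the binomial coefficient `N`.
  have ht : triples 1 = {(0, 0, 1), (1, 0, 0), (0, 1, 0)} := by decide
  rw [ht, Finset.sum_insert (by decide), Finset.sum_insert (by decide),
    Finset.sum_singleton] at h
  simpa [add_assoc] using h

theorem lie [Differential R] (hA : A.OrdLE N) (hB : B.OrdLE M) : ⁅A, B⁆.OrdLE (N + M - 1) := by
  rw [Ring.lie_def]
  refine ((hA.mul hB).sub (add_comm M N ▸ hB.mul hA)).of_coeff_eq_zero ?_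
  rw [coeff_sub, hA.coeff_mul_add hB, add_comm N M, hB.coeff_mul_add hA]
  ring

/-- By commutativity of `R` the products of leading with subleading coefficients cancel, and only
the terms with one derivative survive. -/
theorem coeff_lie [Differential R] (hA : A.OrdLE N) (hB : B.OrdLE M) :
    ⁅A, B⁆.coeff (N + M - 1) =
      N * (A.coeff N * (B.coeff M)′) - M * (B.coeff M * (A.coeff N)′) := by
  rw [Ring.lie_def, coeff_sub, hA.coeff_mul_add_sub_one hB, add_comm N M,
    hB.coeff_mul_add_sub_one hA]
  ring

theorem pow [Differential R] (hA : A.OrdLE 1) (n : ℕ) : (A ^ n).OrdLE n := by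
  induction n with
  | zero => exact fun i hi => by rw [pow_zero, coeff_one, if_neg (by simpa using hi.ne')]
  | succ n ih =>
    rw [pow_succ, Nat.cast_succ]
    exact ih.mul hA

theorem coeff_pow [Differential R] (hA : A.OrdLE 1) (h : A.coeff 1 = 1) (n : ℕ) :
    (A ^ n).coeff n = 1 := by
  induction n with
  | zero => simp [coeff_one]
  | succ n ih => rw [pow_succ, Nat.cast_succ, (hA.pow n).coeff_mul_add hA, ih, h, one_mul]

/-- Perturbing a monic operator of order one by an operator of order `e` perturbs its `n`-th power
in order `n - 1 + e`, by `n` times the leading coefficient of the perturbation. -/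
theorem pow_sub_pow [Differential R] {e : ℤ} (hA : A.OrdLE 1) (hA1 : A.coeff 1 = 1)
    (hB : B.OrdLE 1) (hB1 : B.coeff 1 = 1) (h : (A - B).OrdLE e) (n : ℕ) :
    (A ^ n - B ^ n).OrdLE (n - 1 + e) ∧
      (A ^ n - B ^ n).coeff (n - 1 + e) = n * (A - B).coeff e := by
  induction n with
  | zero =>
    simp only [pow_zero, sub_self, Nat.cast_zero, zero_mul]
    exact ⟨fun _ _ => rfl, rfl⟩
  | succ n ih =>
    -- Telescoping that respects the order of the factors: since `A ^ n` and `B` are monic, the two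
    -- summands contribute `1` and `n` times the leading coefficient of `A - B`.
    have e1 : A ^ (n + 1) - B ^ (n + 1) = A ^ n * (A - B) + (A ^ n - B ^ n) * B := by
      simp only [pow_succ]
      noncomm_ring
    have e2 : ((n + 1 : ℕ) : ℤ) - 1 + e = n + e := by push_cast; ring
    have e3 : (n : ℤ) - 1 + e + 1 = n + e := by ring
    have h1 := ih.1.mul hB
    have h2 := ih.1.coeff_mul_add hB
    rw [e3] at h1 h2
    rw [e1, e2]
    refine ⟨((hA.pow n).mul h).add h1, ?_⟩
    rw [coeff_add, (hA.pow n).coeff_mul_add h, h2, ih.2, hA.coeff_pow hA1, hB1]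
    push_cast
    ring

end OrdLE

section

variable {R : Type*} [CommRing R] [Differential R]

theorem coeff_monomial_zero_mul (c : R) (A : PseudoDiffOp R) (i : ℤ) :
    (monomial 0 c * A).coeff i = c * A.coeff i := by
  rw [coeff_mul, mulCoeff, finsum_eq_single _ ((0, 0) : ℤ × ℕ)]
  · simp [coeff_monomial]
  · rintro ⟨j, k⟩ h
    by_cases hj : j = 0
    · subst hj
      have hk : k ≠ 0 := fun hk => h (by rw [hk])
      simp [Ring.choose_zero_pos ℤ (Nat.pos_of_ne_zero hk)]
    · simp [coeff_monomial, hj]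

/-- Every term with `k ≥ 1` contains a derivative of the constant `c`, so only `k = 0` remains. -/
theorem coeff_mul_monomial_zero {c : R} (hc : c′ = 0) (A : PseudoDiffOp R) (i : ℤ) :
    (A * monomial 0 c).coeff i = A.coeff i * c := by
  rw [coeff_mul, mulCoeff, finsum_eq_single _ ((i, 0) : ℤ × ℕ)]
  · simp [coeff_monomial]
  · rintro ⟨j, k⟩ h
    rcases Nat.eq_zero_or_pos k with rfl | hk
    · have hj : i - j ≠ 0 := fun hj => h (by rw [show j = i by omega])
      simp [coeff_monomial, hj]
    · obtain ⟨k, rfl⟩ := Nat.exists_eq_succ_of_ne_zero hk.ne'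
      dsimp only
      rw [coeff_monomial, Function.iterate_succ_apply, apply_ite (Differential.deriv (R := R)),
        hc, map_zero, ite_self, iterate_deriv_zero, mul_zero, smul_zero]

theorem commute_monomial_zero {c : R} (hc : c′ = 0) (A : PseudoDiffOp R) :
    Commute A (monomial 0 c) :=
  ext fun i => by rw [coeff_mul_monomial_zero hc, coeff_monomial_zero_mul, mul_comm]

/-! ### The `n`-th root of a monic operator -/

/-- The successive approximations of the `n`-th root of `L`, where `u` is the inverse of `n`:
the `k`-th one is correct in all orders above `-k`. -/
noncomputable def rootApprox (L : PseudoDiffOp R) (n : ℕ) (u : R) : ℕ → PseudoDiffOp R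
  | 0 => monomial 1 1
  -- Adding `c ∂^(-k)` changes the `n`-th power to leading order by `n c ∂^(n-1-k)`, so the first
  -- possible error is cancelled by taking `c` to be `1/n` times it.
  | k + 1 => rootApprox L n u k +
      monomial (-k) (u * (L - rootApprox L n u k ^ n).coeff (n - 1 + -k))

variable {L : PseudoDiffOp R} {n : ℕ} {u : R}

theorem rootApprox_succ_sub (k : ℕ) : rootApprox L n u (k + 1) - rootApprox L n u k =
    monomial (-k) (u * (L - rootApprox L n u k ^ n).coeff (n - 1 + -k)) := by
  rw [rootApprox, add_sub_cancel_left]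

theorem coeff_rootApprox_succ {k : ℕ} {i : ℤ} (h : -k < i) :
    (rootApprox L n u (k + 1)).coeff i = (rootApprox L n u k).coeff i := by
  rw [rootApprox, coeff_add, coeff_monomial, if_neg h.ne', add_zero]

theorem coeff_rootApprox_eq {k l : ℕ} (hkl : k ≤ l) {i : ℤ} (h : -k < i) :
    (rootApprox L n u l).coeff i = (rootApprox L n u k).coeff i := by
  induction l, hkl using Nat.le_induction with
  | base => rfl
  | succ l hl ih => rw [coeff_rootApprox_succ (by omega), ih]

theorem ordLE_rootApprox (k : ℕ) : (rootApprox L n u k).OrdLE 1 := by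
  intro i hi
  rw [coeff_rootApprox_eq (Nat.zero_le k) (by simp; omega)]
  exact ordLE_monomial 1 1 i hi

theorem coeff_one_rootApprox (k : ℕ) : (rootApprox L n u k).coeff 1 = 1 := by
  rw [coeff_rootApprox_eq (Nat.zero_le k) (by simp)]
  simp [rootApprox, coeff_monomial]

theorem ordLE_rootApprox_pow_sub (hL : L.OrdLE n) (hL1 : L.coeff n = 1) (hu : n * u = 1) (k : ℕ) :
    (rootApprox L n u k ^ n - L).OrdLE (n - 1 + -k) := by
  induction k with
  | zero =>
    have h := (((ordLE_rootApprox (L := L) (n := n) (u := u) 0).pow n).sub hL).of_coeff_eq_zero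
      (by rw [coeff_sub, (ordLE_rootApprox 0).coeff_pow (coeff_one_rootApprox 0), hL1, sub_self])
    exact h.mono (by simp)
  | succ k ih =>
    have hd : (rootApprox L n u (k + 1) - rootApprox L n u k).OrdLE (-k) := by
      rw [rootApprox_succ_sub]
      exact ordLE_monomial _ _
    obtain ⟨h1, h2⟩ := (ordLE_rootApprox _).pow_sub_pow (coeff_one_rootApprox _)
      (ordLE_rootApprox _) (coeff_one_rootApprox _) hd n
    have h3 := h1.add ih
    rw [sub_add_sub_cancel] at h3
    refine (h3.of_coeff_eq_zero ?_).mono (by push_cast; omega)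
    rw [← sub_add_sub_cancel _ (rootApprox L n u k ^ n) L, coeff_add, h2, rootApprox_succ_sub,
      coeff_monomial, if_pos rfl, ← mul_assoc, hu, one_mul, coeff_sub, coeff_sub]
    ring

/-- A monic operator of order `n` has an `n`-th root, monic of order one, if `n` is invertible. -/
theorem exists_pow_eq (hL : L.OrdLE n) (hL1 : L.coeff n = 1) (hu : n * u = 1) :
    ∃ Q : PseudoDiffOp R, Q.OrdLE 1 ∧ Q.coeff 1 = 1 ∧ Q ^ n = L := by
  -- The coefficient of `∂^i` is final from the `k`-th approximation on as soon as `-k < i`; `(1 -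
  -- i).toNat` is the first such `k`.
  let Q : PseudoDiffOp R := ⟨fun i => (rootApprox L n u (1 - i).toNat).coeff i, 1,
    fun i hi => ordLE_rootApprox _ i hi⟩
  have hQ : ∀ i, Q.coeff i = (rootApprox L n u (1 - i).toNat).coeff i := fun _ => rfl
  have hQ1 : Q.OrdLE 1 := fun i hi => ordLE_rootApprox _ i hi
  have hQ1' : Q.coeff 1 = 1 := (hQ 1).trans (coeff_one_rootApprox _)
  refine ⟨Q, hQ1, hQ1', ext fun i => sub_eq_zero.1 ?_⟩
  -- For this `k`, both `Q ^ n` and `L` agree in order `i` with the `n`-th power of the `k`-th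
  -- approximation.
  obtain ⟨k, hk⟩ : ∃ k : ℕ, (n : ℤ) - 1 + -k < i := ⟨(n - i).toNat, by omega⟩
  have hd : (Q - rootApprox L n u k).OrdLE (-k) := by
    intro j hj
    rw [coeff_sub, hQ, sub_eq_zero]
    exact (coeff_rootApprox_eq (by omega) (by omega)).symm
  have h := (hQ1.pow_sub_pow hQ1' (ordLE_rootApprox _) (coeff_one_rootApprox _) hd n).1.add
    (ordLE_rootApprox_pow_sub hL hL1 hu k)
  rw [sub_add_sub_cancel] at h
  rw [← coeff_sub]
  exact h i hk

/-! ### Removing leading terms by elements of the centralizer -/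

/-- An operator of order less than `m` that almost commutes with the monic operator `L` agrees,
in non-negative orders, with an operator that commutes with `L`. -/
theorem exists_commute_coeff_eq (hL : L.OrdLE n) (hL1 : L.coeff n = 1) (hu : n * u = 1) (m : ℕ)
    {A : PseudoDiffOp R} (hA : A.OrdLE (m - 1)) (h : ⁅L, A⁆.OrdLE (n - 2)) :
    ∃ B : PseudoDiffOp R, Commute L B ∧ ∀ i, 0 ≤ i → B.coeff i = A.coeff i := by
  obtain ⟨Q, hQ, hQ1, hQL⟩ := exists_pow_eq hL hL1 hu
  have hLQ : Commute L Q := hQL ▸ Commute.pow_left (Commute.refl Q) n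
  induction m generalizing A with
  | zero =>
    exact ⟨0, Commute.zero_right L, fun i hi => (hA i (by simp; omega)).symm⟩
  | succ m ih =>
    rw [Nat.cast_succ, add_sub_cancel_right] at hA
    -- The order `n + m - 1` exceeds `n - 2` exactly because `m ≥ 0`, so the leading coefficient of
    -- the commutator must vanish.
    have hc : (A.coeff m)′ = 0 := by
      have h1 := hL.coeff_lie hA
      rw [h _ (by omega), hL1] at h1
      have h2 : (n : R) * (A.coeff m)′ = 0 := by simpa using h1.symm
      calc (A.coeff m)′ = u * (n * (A.coeff m)′) := by
            rw [← mul_assoc, mul_comm u, hu, one_mul]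
        _ = 0 := by rw [h2, mul_zero]
    -- `C` may have terms of negative order even when `A` is a differential operator, which is why
    -- the induction runs over all pseudo-differential operators.
    set C := monomial 0 (A.coeff m) * Q ^ m
    have hLC : Commute L C := (commute_monomial_zero hc L).mul_right (hLQ.pow_right m)
    have hC : ∀ i, C.coeff i = A.coeff m * (Q ^ m).coeff i := coeff_monomial_zero_mul _ _
    have hC' : C.OrdLE m := fun i hi => by rw [hC, hQ.pow m i hi, mul_zero]
    obtain ⟨B, hB, hBA⟩ := ih (A := A - C)
      ((hA.sub hC').of_coeff_eq_zero
        (by rw [coeff_sub, hC, hQ.coeff_pow hQ1, mul_one, sub_self]))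
      (by rwa [lie_sub_of_commute hLC])
    exact ⟨B + C, hB.add_right hLC, fun i hi => by
      rw [coeff_add, hBA i hi, coeff_sub, sub_add_cancel]⟩

theorem coeff_posPart (A : PseudoDiffOp R) (i : ℤ) :
    (A.posPart : PseudoDiffOp R).coeff i = if 0 ≤ i then A.coeff i else 0 := rfl

end

end PseudoDiffOp

/-! ### The two inclusions -/

open PseudoDiffOp in
theorem mem_almostCommuting_iff {R : Type*} [CommRing R] [Differential R] {L A : diffOp R}
    {n : ℕ} : A ∈ almostCommuting L n ↔
      ⁅(L : PseudoDiffOp R), (A : PseudoDiffOp R)⁆.OrdLE (n - 2) :=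
  ord_le_iff _ _

theorem exists_natCast_mul_eq_one {R : Type*} [CommRing R] [Differential R]
    (hfield : IsField (constants R)) (hchar : CharZero (constants R)) {n : ℕ} (hn : n ≠ 0) :
    ∃ u : R, n * u = 1 := by
  obtain ⟨u, hu⟩ := hfield.mul_inv_cancel (a := (n : constants R)) (Nat.cast_ne_zero.2 hn)
  exact ⟨u, by simpa using congrArg Subtype.val hu⟩

open PseudoDiffOp in
theorem mainTheorem1 {R : Type*} [CommRing R] [Differential R]
    (hfield : IsField (constants R)) (hchar : CharZero (constants R))
    (L : diffOp R) (n : ℕ) (hL : IsMonicOfOrder L n) :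
    PseudoDiffOp.posPart '' pseudoCentralizer L = almostCommuting L n := by
  obtain ⟨hord, hL1⟩ := hL
  have hLn : (L : PseudoDiffOp R).OrdLE n := (ord_le_iff _ _).1 hord.le
  ext A
  rw [mem_almostCommuting_iff]
  constructor
  · rintro ⟨B, hB, rfl⟩
    have hd : ((B.posPart : PseudoDiffOp R) - B).OrdLE (-1) := fun i hi => by
      rw [coeff_sub, coeff_posPart, if_pos (by omega), sub_self]
    have h := hLn.lie hd
    rw [lie_sub_of_commute (sub_eq_zero.1 hB)] at h
    exact h.mono (by omega)
  · intro hA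
    suffices h : ∃ B : PseudoDiffOp R, Commute (L : PseudoDiffOp R) B ∧
        ∀ i, 0 ≤ i → B.coeff i = (A : PseudoDiffOp R).coeff i by
      obtain ⟨B, hB, hBA⟩ := h
      refine ⟨B, hB.lie_eq, Subtype.ext (PseudoDiffOp.ext fun i => ?_)⟩
      rw [coeff_posPart]
      split_ifs with hi
      · exact hBA i hi
      · exact (A.2 i (not_le.1 hi)).symm
    rcases eq_or_ne n 0 with rfl | hn
    -- For `n = 0` there is no root to extract, but a monic differential operator of order `0` is
    -- `1`, and `A` itself lies in the centralizer.
    · have hone : (L : PseudoDiffOp R) = 1 := PseudoDiffOp.ext fun i => by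
        rw [coeff_one]
        split_ifs with hi
        · rw [hi]
          exact hL1
        · rcases lt_or_gt_of_ne hi with hi | hi
          · exact L.2 i hi
          · exact hLn i hi
      exact ⟨A, hone ▸ Commute.one_left _, fun _ _ => rfl⟩
    · obtain ⟨u, hu⟩ := exists_natCast_mul_eq_one hfield hchar hn
      obtain ⟨N, hN⟩ := (A : PseudoDiffOp R).exists_bound
      -- With `m = (N + 1).toNat` one has `N ≤ m - 1`, also when `N` is negative and `m = 0`.
      exact exists_commute_coeff_eq hLn hL1 hu (N + 1).toNat
        (OrdLE.mono (N := N) hN (by omega)) hA
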